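/- For integers $k,l\ge 2$ with $l$ odd or $k$ even, let $n(k,l)$ denote the largest natural number $n$ such that every element of the alternating group $A_n$ is a product of exactly $k$ (not necessarily distinct or disjoint) $l$-cycles of the symmetric group $S_n$. Theorem. Let $k\ge 2$ be even. Then the largest number $n(k,6)$ exists, and $n(k,6)\ge 4k$. Moreover, every element of $A_{4k}$ is a product of $k$ many $6$-cycles of $S_{4k}$. -/

import Mathlib

/-- `IsProdOfCycles k l σ`: the permutation `σ` of `{0, …, n-1}` is a product of exactly `k`
(not necessarily distinct or disjoint) `l`-cycles of the symmetric group on the same symbols. -/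
def IsProdOfCycles {n : ℕ} (k l : ℕ) (σ : Equiv.Perm (Fin n)) : Prop :=
  ∃ L : List (Equiv.Perm (Fin n)),
    L.length = k ∧ (∀ τ ∈ L, τ.IsCycle ∧ τ.support.card = l) ∧ L.prod = σ

/-- The set of all `n` such that every element of `A_n` is a product of `k` many `l`-cycles. -/
def cycleCoverSet (k l : ℕ) : Set ℕ :=
  {n | ∀ σ ∈ alternatingGroup (Fin n), IsProdOfCycles k l σ}

/-- The largest `n` such that every element of `A_n` is a product of `k` many `l`-cycles
(meaningful when this set of `n` has a largest element). -/
noncomputable def maxCycleCover (k l : ℕ) : ℕ := sSup (cycleCoverSet k l)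

open Equiv Equiv.Perm

/-! Two `6`-cycles clear eight symbols. Every even permutation of at most 8 symbols is a product of
two `6`-cycles once `8 ≤ n`. A larger even `σ` factors as `π * ρ`, with `π` a product of two
`6`-cycles and `ρ` moving at most `max 8 (|supp σ| - 8)` symbols (`exists_isProdTwoSixCycles_mul`).
Induction on `t` then writes every even permutation moving at most `8 * t` symbols with `2 * t`
six-cycles; `k = 2 * t` gives `4 * k`.

The factor `π` is assembled from whole cycles of `σ` and initial arcs of cycles. A cut leaves its
cut point in `ρ`, so the number of symbols cleared is the sum of the type of `π` minus the number of
cuts. Types of sum 8, 9, 10 with 0, 1, 2 cuts each clear eight.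

The maximum exists because a product of `k` many `l`-cycles moves at most `k * l` symbols, while
`A_n` has fixed-point-free elements for `n ≥ 3`. -/

/-- `σ` is a product of two `6`-cycles. -/
def IsProdTwoSixCycles {n : ℕ} (σ : Perm (Fin n)) : Prop :=
  ∃ a b : Perm (Fin n), a.cycleType = {6} ∧ b.cycleType = {6} ∧ a * b = σ

theorem cycleType_eq_singleton_iff {α : Type*} [Fintype α] [DecidableEq α] {l : ℕ} {σ : Perm α} :
    σ.cycleType = {l} ↔ σ.IsCycle ∧ σ.support.card = l := by
  refine ⟨fun h => ?_, fun h => by rw [h.1.cycleType, h.2]⟩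
  exact ⟨card_cycleType_eq_one.1 (by simp [h]), by rw [← sum_cycleType, h, Multiset.sum_singleton]⟩

theorem IsProdTwoSixCycles.of_cycleType_eq {n : ℕ} {σ τ : Perm (Fin n)}
    (hσ : IsProdTwoSixCycles σ) (h : σ.cycleType = τ.cycleType) : IsProdTwoSixCycles τ := by
  obtain ⟨a, b, ha, hb, rfl⟩ := hσ
  obtain ⟨c, rfl⟩ := isConj_iff.1 (isConj_iff_cycleType_eq.2 h)
  exact ⟨c * a * c⁻¹, c * b * c⁻¹, by rw [cycleType_conj, ha], by rw [cycleType_conj, hb],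
    by group⟩

theorem cycleType_list_formPerm {α : Type*} [Fintype α] [DecidableEq α] {l : List α}
    (hl : l.Nodup) (h2 : 2 ≤ l.length) : l.formPerm.cycleType = {l.length} := by
  refine cycleType_eq_singleton_iff.2 ⟨List.isCycle_formPerm hl h2, ?_⟩
  rw [List.support_formPerm_of_nodup l hl (by rintro x rfl; simp at h2),
    List.toFinset_card_of_nodup hl]

theorem cycleType_prod_formPerm {α : Type*} [Fintype α] [DecidableEq α] (L : List (List α))
    (hL : L.flatten.Nodup) (h2 : ∀ l ∈ L, 2 ≤ l.length) :
    (L.map List.formPerm).prod.cycleType = (L.map List.length : List ℕ) := by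
  have hd : ∀ L : List (List α), ∀ x, x ∉ L.flatten → (L.map List.formPerm).prod x = x := by
    intro L x hx
    induction L with
    | nil => rfl
    | cons l L ih =>
      simp only [List.flatten_cons, List.mem_append, not_or] at hx
      simp [ih hx.2, List.formPerm_apply_of_notMem hx.1]
  induction L with
  | nil => simp
  | cons l L ih =>
    rw [List.flatten_cons, List.nodup_append] at hL
    have hdis : Perm.Disjoint l.formPerm (L.map List.formPerm).prod := by
      intro x
      by_cases hx : x ∈ l
      · exact Or.inr (hd L x fun hx' => hL.2.2 x hx x hx' rfl)
      · exact Or.inl (List.formPerm_apply_of_notMem hx)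
    rw [List.map_cons, List.prod_cons, hdis.cycleType_mul,
      ih hL.2.1 fun l hl => h2 l (List.mem_cons_of_mem _ hl),
      cycleType_list_formPerm hL.1 (h2 l List.mem_cons_self), List.map_cons, ← Multiset.cons_coe,
      Multiset.singleton_add]

/-- Reduces a cycle type to one identity in a small `Fin m`, which `decide` can check: the identity
embeds in `Fin n`, and conjugation reaches every permutation of that type. -/
theorem isProdTwoSixCycles_of_lists {n m : ℕ} {σ : Perm (Fin n)} (hmn : m ≤ n)
    (a b : List (Fin m)) (L : List (List (Fin m))) (ha : a.Nodup) (hb : b.Nodup)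
    (ha6 : a.length = 6) (hb6 : b.length = 6) (hL : L.flatten.Nodup)
    (h2 : ∀ l ∈ L, 2 ≤ l.length)
    (hprod : ∀ x, a.formPerm (b.formPerm x) = (L.map List.formPerm).prod x)
    (hσ : σ.cycleType = (L.map List.length : List ℕ)) : IsProdTwoSixCycles σ := by
  let f := (Fin.castLEEmb hmn).toEquivRange
  have key : IsProdTwoSixCycles ((L.map List.formPerm).prod.extendDomain f) := by
    refine ⟨a.formPerm.extendDomain f, b.formPerm.extendDomain f, ?_, ?_, ?_⟩
    · rw [cycleType_extendDomain, cycleType_list_formPerm ha (by omega), ha6]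
    · rw [cycleType_extendDomain, cycleType_list_formPerm hb (by omega), hb6]
    · rw [extendDomain_mul]
      congr 1
      exact Equiv.ext hprod
  exact key.of_cycleType_eq (by rw [cycleType_extendDomain, cycleType_prod_formPerm L hL h2, hσ])

/-- A list of cycle types of products of two `6`-cycles, containing every even cycle type on at
most `8` symbols. -/
def twoSixCycleTypes : List (Multiset ℕ) :=
  [0, {3}, {2, 2}, {5}, {4, 2}, {3, 3}, {7}, {3, 2, 2}, {2, 2, 2, 2}, {4, 4}, {5, 3}, {6, 2},
  {9}, {5, 2, 2}, {4, 3, 2}, {3, 3, 3}, {5, 5}, {6, 4}, {7, 3}, {8, 2}]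

theorem isProdTwoSixCycles_of_cycleType_mem {n : ℕ} (hn : 8 ≤ n) {σ : Perm (Fin n)}
    (h : σ.cycleType ∈ twoSixCycleTypes) : IsProdTwoSixCycles σ := by
  -- For the types of sum 9 and 10 this supplies `9 ≤ n` and `10 ≤ n`; the others need only `hn`.
  have hs := σ.sum_cycleType_le
  rw [Fintype.card_fin] at hs
  simp only [twoSixCycleTypes, List.mem_cons, List.not_mem_nil, or_false] at h
  rcases h with hσ | hσ | hσ | hσ | hσ | hσ | hσ | hσ | hσ | hσ | hσ | hσ | hσ | hσ | hσ | hσ |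
    hσ | hσ | hσ | hσ <;> simp only [hσ, Multiset.insert_eq_cons, Multiset.sum_cons,
      Multiset.sum_singleton, Multiset.sum_zero] at hs
  · exact isProdTwoSixCycles_of_lists (m := 8) (by omega) [3, 4, 7, 0, 2, 6] [2, 0, 7, 4, 3, 6]
      []
      (by decide) (by decide) rfl rfl (by decide) (by decide) (by decide) hσ
  · exact isProdTwoSixCycles_of_lists (m := 8) (by omega) [0, 2, 3, 1, 4, 5] [3, 2, 5, 4, 1, 0]
      [[0, 1, 2]]
      (by decide) (by decide) rfl rfl (by decide) (by decide) (by decide) hσ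
  · exact isProdTwoSixCycles_of_lists (m := 8) (by omega) [1, 6, 4, 5, 2, 0] [2, 3, 5, 4, 6, 1]
      [[0, 1], [2, 3]]
      (by decide) (by decide) rfl rfl (by decide) (by decide) (by decide) hσ
  · exact isProdTwoSixCycles_of_lists (m := 8) (by omega) [4, 6, 2, 3, 5, 1] [0, 5, 3, 1, 6, 4]
      [[0, 1, 2, 3, 4]]
      (by decide) (by decide) rfl rfl (by decide) (by decide) (by decide) hσ
  · exact isProdTwoSixCycles_of_lists (m := 8) (by omega) [1, 2, 5, 7, 6, 0] [4, 2, 3, 6, 7, 5]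
      [[0, 1, 2, 3], [4, 5]]
      (by decide) (by decide) rfl rfl (by decide) (by decide) (by decide) hσ
  · exact isProdTwoSixCycles_of_lists (m := 8) (by omega) [6, 7, 2, 0, 1, 4] [4, 5, 3, 1, 7, 6]
      [[0, 1, 2], [3, 4, 5]]
      (by decide) (by decide) rfl rfl (by decide) (by decide) (by decide) hσ
  · exact isProdTwoSixCycles_of_lists (m := 8) (by omega) [3, 6, 0, 5, 7, 2] [3, 4, 0, 1, 7, 5]
      [[0, 1, 2, 3, 4, 5, 6]]
      (by decide) (by decide) rfl rfl (by decide) (by decide) (by decide) hσ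
  · exact isProdTwoSixCycles_of_lists (m := 8) (by omega) [6, 2, 0, 5, 1, 3] [6, 0, 5, 3, 4, 1]
      [[0, 1, 2], [3, 4], [5, 6]]
      (by decide) (by decide) rfl rfl (by decide) (by decide) (by decide) hσ
  · exact isProdTwoSixCycles_of_lists (m := 8) (by omega) [5, 4, 2, 3, 1, 6] [0, 3, 4, 6, 7, 1]
      [[0, 1], [2, 3], [4, 5], [6, 7]]
      (by decide) (by decide) rfl rfl (by decide) (by decide) (by decide) hσ
  · exact isProdTwoSixCycles_of_lists (m := 8) (by omega) [2, 7, 5, 4, 0, 1] [6, 2, 3, 4, 7, 5]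
      [[0, 1, 2, 3], [4, 5, 6, 7]]
      (by decide) (by decide) rfl rfl (by decide) (by decide) (by decide) hσ
  · exact isProdTwoSixCycles_of_lists (m := 8) (by omega) [6, 7, 5, 3, 2, 1] [2, 5, 1, 3, 4, 0]
      [[0, 1, 2, 3, 4], [5, 6, 7]]
      (by decide) (by decide) rfl rfl (by decide) (by decide) (by decide) hσ
  · exact isProdTwoSixCycles_of_lists (m := 8) (by omega) [6, 2, 3, 1, 5, 0] [3, 4, 1, 6, 7, 0]
      [[0, 1, 2, 3, 4, 5], [6, 7]]
      (by decide) (by decide) rfl rfl (by decide) (by decide) (by decide) hσ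
  · exact isProdTwoSixCycles_of_lists (m := 9) (by omega) [7, 8, 4, 1, 2, 3] [5, 6, 3, 8, 0, 4]
      [[0, 1, 2, 3, 4, 5, 6, 7, 8]]
      (by decide) (by decide) rfl rfl (by decide) (by decide) (by decide) hσ
  · exact isProdTwoSixCycles_of_lists (m := 9) (by omega) [8, 5, 4, 0, 1, 7] [1, 2, 3, 5, 6, 8]
      [[0, 1, 2, 3, 4], [5, 6], [7, 8]]
      (by decide) (by decide) rfl rfl (by decide) (by decide) (by decide) hσ
  · exact isProdTwoSixCycles_of_lists (m := 9) (by omega) [1, 2, 5, 7, 8, 0] [2, 3, 8, 5, 6, 4]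
      [[0, 1, 2, 3], [4, 5, 6], [7, 8]]
      (by decide) (by decide) rfl rfl (by decide) (by decide) (by decide) hσ
  · exact isProdTwoSixCycles_of_lists (m := 9) (by omega) [6, 7, 4, 5, 0, 1] [1, 2, 5, 3, 7, 8]
      [[0, 1, 2], [3, 4, 5], [6, 7, 8]]
      (by decide) (by decide) rfl rfl (by decide) (by decide) (by decide) hσ
  · exact isProdTwoSixCycles_of_lists (m := 10) (by omega) [0, 1, 2, 6, 3, 4] [7, 8, 9, 5, 2, 6]
      [[0, 1, 2, 3, 4], [5, 6, 7, 8, 9]]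
      (by decide) (by decide) rfl rfl (by decide) (by decide) (by decide) hσ
  · exact isProdTwoSixCycles_of_lists (m := 10) (by omega) [5, 0, 1, 7, 8, 9] [4, 9, 6, 1, 2, 3]
      [[0, 1, 2, 3, 4, 5], [6, 7, 8, 9]]
      (by decide) (by decide) rfl rfl (by decide) (by decide) (by decide) hσ
  · exact isProdTwoSixCycles_of_lists (m := 10) (by omega) [6, 0, 9, 7, 8, 5] [8, 0, 1, 2, 3, 4]
      [[0, 1, 2, 3, 4, 5, 6], [7, 8, 9]]
      (by decide) (by decide) rfl rfl (by decide) (by decide) (by decide) hσ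
  · exact isProdTwoSixCycles_of_lists (m := 10) (by omega) [7, 0, 9, 8, 5, 6] [3, 4, 8, 0, 1, 2]
      [[0, 1, 2, 3, 4, 5, 6, 7], [8, 9]]
      (by decide) (by decide) rfl rfl (by decide) (by decide) (by decide) hσ

/-! ### Splitting factors off a permutation -/

/-- `σ = π * ρ` where `π` has cycle type `p` and `ρ` moves at most `r` symbols, all of the symbols
moved by `π` and `ρ` being moved by `σ`. -/
def SplitsOff {α : Type*} [Fintype α] [DecidableEq α] (σ : Perm α) (p : Multiset ℕ) (r : ℕ) :
    Prop :=
  ∃ π ρ : Perm α, π * ρ = σ ∧ π.cycleType = p ∧ π.support ⊆ σ.support ∧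
    ρ.support ⊆ σ.support ∧ ρ.support.card ≤ r

/-- Every permutation of `Fin n` of cycle type `M` splits off a factor of cycle type `p`. -/
def TypeSplitsOff (n : ℕ) (M p : Multiset ℕ) (r : ℕ) : Prop :=
  ∀ σ : Perm (Fin n), σ.cycleType = M → SplitsOff σ p r

/-- The support inclusions make `ρ` and `π'` disjoint, so they commute and the factors can be
regrouped. -/
theorem SplitsOff.mul {α : Type*} [Fintype α] [DecidableEq α] {σ τ : Perm α} {p q : Multiset ℕ}
    {r s : ℕ} (hd : σ.Disjoint τ) (hσ : SplitsOff σ p r) (hτ : SplitsOff τ q s) :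
    SplitsOff (σ * τ) (p + q) (r + s) := by
  obtain ⟨π, ρ, h, hp, hπ, hρ, hr⟩ := hσ
  obtain ⟨π', ρ', h', hq, hπ', hρ', hs⟩ := hτ
  rw [disjoint_iff_disjoint_support] at hd
  have hρπ : ρ.Disjoint π' := disjoint_iff_disjoint_support.2 (hd.mono hρ hπ')
  have hππ : π.Disjoint π' := disjoint_iff_disjoint_support.2 (hd.mono hπ hπ')
  have hsupp : (σ * τ).support = σ.support ∪ τ.support :=
    (disjoint_iff_disjoint_support.2 hd).support_mul
  refine ⟨π * π', ρ * ρ', ?_, ?_, ?_, ?_, ?_⟩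
  · rw [← h, ← h', mul_assoc, ← mul_assoc π' ρ, ← hρπ.commute.eq, mul_assoc, mul_assoc]
  · rw [hππ.cycleType_mul, hp, hq]
  · rw [hsupp]
    exact (support_mul_le π π').trans (Finset.union_subset_union hπ hπ')
  · rw [hsupp]
    exact (support_mul_le ρ ρ').trans (Finset.union_subset_union hρ hρ')
  · exact (Finset.card_le_card (support_mul_le ρ ρ')).trans
      ((Finset.card_union_le _ _).trans (by omega))

theorem formPerm_append_singleton_append {α : Type*} [DecidableEq α] (l : List α) (x : α)
    (l' : List α) :
    (l ++ x :: l').formPerm = (l ++ [x]).formPerm * (x :: l').formPerm := by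
  induction l with
  | nil => simp
  | cons y l ih =>
    cases l with
    | nil => simp
    | cons z l =>
      simp only [List.cons_append, List.formPerm_cons_cons] at ih ⊢
      rw [ih, mul_assoc]

/-- `(x₁ … x_m) = (x₁ … x_j)(x_j … x_m)`; the shared point `x_j` accounts for the `+ 1`. -/
theorem splitsOff_cut {α : Type*} [Fintype α] [DecidableEq α] {c : Perm α} (hc : c.IsCycle)
    {j : ℕ} (h2 : 2 ≤ j) (hj : j ≤ c.support.card) :
    SplitsOff c {j} (c.support.card - j + 1) := by
  obtain ⟨x, hx⟩ := hc.nonempty_support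
  have hl : (c.toList x).formPerm = c := by
    rw [formPerm_toList, hc.cycleOf_eq (mem_support.1 hx)]
  have hlen : (c.toList x).length = c.support.card := by
    rw [length_toList, hc.cycleOf_eq (mem_support.1 hx)]
  have hnd := nodup_toList c x
  have hsup : ∀ l : List α, l ⊆ c.toList x → l.formPerm.support ⊆ c.support := by
    intro l hlx y hy
    have hy' := hlx (List.mem_toFinset.1 (List.support_formPerm_le l hy))
    have hsame := (mem_toList_iff.1 hy').1
    exact mem_support.2 fun h => mem_support.1 hx ((hsame.apply_eq_self_iff).2 h)
  generalize c.toList x = l at *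
  obtain ⟨l₁, y, l₂, rfl, hl₁⟩ : ∃ l₁ y l₂, l = l₁ ++ y :: l₂ ∧ l₁.length = j - 1 := by
    refine ⟨l.take (j - 1), l[j - 1], l.drop j, ?_, by simp; omega⟩
    have := List.drop_eq_getElem_cons (l := l) (i := j - 1) (by omega)
    rw [show j - 1 + 1 = j by omega] at this
    rw [← this, List.take_append_drop]
  have hsub₁ : l₁ ++ [y] ⊆ l₁ ++ y :: l₂ := by
    intro z; simp only [List.mem_append, List.mem_cons, List.not_mem_nil]; tauto
  have hsub₂ : y :: l₂ ⊆ l₁ ++ y :: l₂ := List.subset_append_right _ _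
  have hnd₁ : (l₁ ++ [y]).Nodup :=
    hnd.sublist (List.Sublist.append_left (by simp) _)
  rw [List.length_append, List.length_cons] at hlen
  refine ⟨(l₁ ++ [y]).formPerm, (y :: l₂).formPerm, ?_, ?_, hsup _ hsub₁, hsup _ hsub₂, ?_⟩
  · rw [← formPerm_append_singleton_append, hl]
  · rw [cycleType_list_formPerm hnd₁ (by simp; omega)]
    simp only [List.length_append, List.length_singleton, Multiset.singleton_inj]
    omega
  · refine (Finset.card_le_card (List.support_formPerm_le _)).trans
      ((List.toFinset_card_le _).trans ?_)
    rw [List.length_cons]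
    omega

theorem splitsOff_self {α : Type*} [Fintype α] [DecidableEq α] (σ : Perm α) :
    SplitsOff σ σ.cycleType 0 :=
  ⟨σ, 1, mul_one σ, rfl, subset_rfl, by simp, by simp⟩

theorem splitsOff_zero {α : Type*} [Fintype α] [DecidableEq α] (σ : Perm α) :
    SplitsOff σ 0 σ.support.card :=
  ⟨1, σ, one_mul σ, cycleType_one, by simp, subset_rfl, le_rfl⟩

theorem exists_cycle_mul_of_cycleType_eq_cons {α : Type*} [Fintype α] [DecidableEq α]
    {σ : Perm α} {m : ℕ} {M : Multiset ℕ} (h : σ.cycleType = m ::ₘ M) :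
    ∃ c τ : Perm α, σ = c * τ ∧ c.Disjoint τ ∧ c.IsCycle ∧ c.support.card = m ∧
      τ.cycleType = M := by
  obtain ⟨c, τ, rfl, hd, hc, hm⟩ := mem_cycleType_iff.1 (h ▸ Multiset.mem_cons_self m M)
  refine ⟨c, τ, rfl, hd, hc, hm, ?_⟩
  rw [hd.cycleType_mul, hc.cycleType, hm, Multiset.singleton_add] at h
  exact (Multiset.cons_inj_right m).1 h

namespace TypeSplitsOff

variable {n : ℕ} {M p : Multiset ℕ} {r : ℕ}

theorem mono (h : TypeSplitsOff n M p r) {s : ℕ} (hrs : r ≤ s) : TypeSplitsOff n M p s := by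
  intro σ hσ
  obtain ⟨π, ρ, h1, h2, h3, h4, h5⟩ := h σ hσ
  exact ⟨π, ρ, h1, h2, h3, h4, h5.trans hrs⟩

theorem zero (n : ℕ) (M : Multiset ℕ) : TypeSplitsOff n M 0 M.sum := by
  rintro σ rfl
  rw [sum_cycleType]
  exact splitsOff_zero σ

theorem cut (h : TypeSplitsOff n M p r) {m j : ℕ} (h2 : 2 ≤ j) (hj : j ≤ m) :
    TypeSplitsOff n (m ::ₘ M) (j ::ₘ p) (m - j + 1 + r) := by
  intro σ hσ
  obtain ⟨c, τ, rfl, hd, hc, rfl, hτ⟩ := exists_cycle_mul_of_cycleType_eq_cons hσ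
  exact (splitsOff_cut hc h2 hj).mul hd (h τ hτ)

theorem take (h : TypeSplitsOff n M p r) (m : ℕ) :
    TypeSplitsOff n (m ::ₘ M) (m ::ₘ p) r := by
  intro σ hσ
  obtain ⟨c, τ, rfl, hd, hc, rfl, hτ⟩ := exists_cycle_mul_of_cycleType_eq_cons hσ
  have := (splitsOff_self c).mul hd (h τ hτ)
  rwa [hc.cycleType, Multiset.singleton_add, zero_add] at this

theorem skip (h : TypeSplitsOff n M p r) (m : ℕ) : TypeSplitsOff n (m ::ₘ M) p (m + r) := by
  intro σ hσ
  obtain ⟨c, τ, rfl, hd, hc, rfl, hτ⟩ := exists_cycle_mul_of_cycleType_eq_cons hσ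
  have := (splitsOff_zero c).mul hd (h τ hτ)
  rwa [zero_add] at this

end TypeSplitsOff

/-! ### Choosing the factor to split off -/

theorem mem_twoSixCycleTypes_of_sum_le (l : List ℕ) (h2 : ∀ m ∈ l, 2 ≤ m) (hs : l.sum ≤ 8)
    (he : Even (l.sum + l.length)) : (l : Multiset ℕ) ∈ twoSixCycleTypes := by
  rcases l with _ | ⟨a, _ | ⟨b, _ | ⟨c, _ | ⟨d, _ | ⟨e, l⟩⟩⟩⟩⟩ <;>
    simp only [List.mem_cons, List.not_mem_nil, forall_eq_or_imp, forall_const, List.sum_cons,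
      List.sum_nil, IsEmpty.forall_iff, List.length_cons, List.length_nil, and_true] at h2 hs he
  · decide
  · have : a ≤ 8 := by omega
    interval_cases a <;> first | decide | (exfalso; revert he; decide)
  · obtain ⟨ha, hb⟩ := h2
    have : a ≤ 6 := by omega
    have : b ≤ 6 := by omega
    interval_cases a <;> interval_cases b <;> first | omega | decide | (exfalso; revert he; decide)
  · obtain ⟨ha, hb, hc⟩ := h2
    have : a ≤ 4 := by omega
    have : b ≤ 4 := by omega
    have : c ≤ 4 := by omega
    interval_cases a <;> interval_cases b <;> interval_cases c <;>
      first | omega | decide | (exfalso; revert he; decide)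
  · obtain ⟨rfl, rfl, rfl, rfl⟩ : a = 2 ∧ b = 2 ∧ c = 2 ∧ d = 2 := by omega
    decide
  · omega

theorem pair_mem_twoSixCycleTypes {x y : ℕ} (hxy : x + y = 8) (hx : 2 ≤ x) (hy : 2 ≤ y) :
    ({x, y} : Multiset ℕ) ∈ twoSixCycleTypes := by
  obtain rfl : x = 8 - y := by omega
  have : y ≤ 6 := by omega
  interval_cases y <;> decide

theorem exists_typeSplitsOff (n : ℕ) (l : List ℕ) (hl : l.Pairwise (· ≥ ·))
    (h2 : ∀ m ∈ l, 2 ≤ m) (hs : 9 ≤ l.sum) (he : Even (l.sum + l.length)) :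
    ∃ p ∈ twoSixCycleTypes, TypeSplitsOff n l p (max 8 (l.sum - 8)) := by
  rcases l with _ | ⟨a, l⟩
  · simp at hs
  have z := TypeSplitsOff.zero n l
  rw [Multiset.sum_coe] at z
  by_cases ha9 : 9 ≤ a
  · exact ⟨{9}, by decide, (z.cut (by omega) ha9).mono (by simp only [List.sum_cons]; omega)⟩
  rcases l with _ | ⟨b, l⟩
  · simp at hs; omega
  replace z := TypeSplitsOff.zero n l
  rw [Multiset.sum_coe] at z
  simp only [List.pairwise_cons, List.mem_cons, forall_eq_or_imp] at hl h2
  obtain ⟨⟨hab, -⟩, hbl, hl⟩ := hl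
  obtain ⟨ha2, hb2, h2⟩ := h2
  simp only [List.sum_cons, List.length_cons] at hs he ⊢
  by_cases h10 : 10 ≤ a + b
  -- Two cuts of total length 10; as `b ≤ a`, capping the shorter one at 5 ensures both fit.
  · refine ⟨{10 - min b 5, min b 5}, ?_, ((z.cut (m := b) (j := min b 5) (by omega)
      (by omega)).cut (m := a) (j := 10 - min b 5) (by omega) (by omega)).mono (by omega)⟩
    have h1 : 2 ≤ min b 5 := by omega
    have h3 : min b 5 ≤ 5 := by omega
    generalize min b 5 = t at *
    interval_cases t <;> decide
  by_cases h8 : a + b = 8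
  · exact ⟨{a, b}, pair_mem_twoSixCycleTypes h8 ha2 hb2, ((z.take b).take a).mono (by omega)⟩
  rcases l with _ | ⟨c, l⟩
  -- Two cycles of total length 9 form an odd permutation.
  · simp only [List.sum_nil, List.length_nil] at hs he
    exfalso
    rw [show a + (b + 0) = 9 by omega] at he
    revert he; decide
  replace z := TypeSplitsOff.zero n l
  rw [Multiset.sum_coe] at z
  simp only [List.pairwise_cons, List.mem_cons, forall_eq_or_imp] at hl hbl h2
  obtain ⟨hbc, -⟩ := hbl
  obtain ⟨hcl, hl⟩ := hl
  obtain ⟨hc2, h2⟩ := h2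
  simp only [List.sum_cons, List.length_cons] at hs he ⊢
  by_cases hac : a + c = 8
  · exact ⟨{a, c}, pair_mem_twoSixCycleTypes hac ha2 hc2,
      (((z.take c).skip b).take a).mono (by omega)⟩
  by_cases hbc8 : b + c = 8
  · exact ⟨{b, c}, pair_mem_twoSixCycleTypes hbc8 hb2 hc2,
      (((z.take c).take b).skip a).mono (by omega)⟩
  by_cases h9 : 9 ≤ a + b + c
  -- One cut, total length 9. Here `b ≤ 4` and `b + c ≠ 8`, so the arc has length at least 2.
  · refine ⟨{9 - b - c, b, c}, ?_, (((z.take c).take b).cut (m := a) (j := 9 - b - c) (by omega)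
      (by omega)).mono (by omega)⟩
    have : b ≤ 4 := by omega
    have : c ≤ 4 := by omega
    interval_cases b <;> interval_cases c <;> first | omega | decide
  rcases l with _ | ⟨d, l⟩
  · simp only [List.sum_nil] at hs
    omega
  replace z := TypeSplitsOff.zero n l
  rw [Multiset.sum_coe] at z
  simp only [List.pairwise_cons, List.mem_cons, forall_eq_or_imp] at hl hcl h2
  obtain ⟨hcd, -⟩ := hcl
  obtain ⟨hdl, hl⟩ := hl
  obtain ⟨hd2, h2⟩ := h2
  simp only [List.sum_cons, List.length_cons] at hs he ⊢
  -- Now `a + b + c ≤ 8`, so all cycles after the first two are transpositions. Four transpositions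
  -- clear eight symbols; with fewer, the remainder fits in the bound 8.
  obtain rfl : c = 2 := by omega
  obtain rfl : d = 2 := by omega
  have hl2 : ∀ m ∈ l, m = 2 := fun m hm => le_antisymm (hdl m hm) (h2 m hm)
  obtain ⟨r, rfl⟩ : ∃ r, l = List.replicate r 2 := ⟨_, List.eq_replicate_of_mem hl2⟩
  simp only [List.sum_replicate, List.length_replicate, smul_eq_mul] at hs he z ⊢
  by_cases hb : b = 2
  · subst hb
    by_cases ha : a = 2
    · subst ha
      exact ⟨{2, 2, 2, 2}, by decide, ((((z.take 2).take 2).take 2).take 2).mono (by omega)⟩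
    rcases r with _ | r
    · rcases (show a = 3 ∨ a = 4 by omega) with rfl | rfl
      · exfalso; revert he; decide
      · exact ⟨{4, 2}, by decide, ((((z.skip 2).skip 2).take 2).take 4).mono (by omega)⟩
    · have z' := TypeSplitsOff.zero n (List.replicate r 2)
      rw [Multiset.sum_coe, List.sum_replicate, smul_eq_mul] at z'
      exact ⟨{2, 2, 2, 2}, by decide, (((((z'.take 2).take 2).take 2).take 2).skip a).mono
        (by omega)⟩
  · obtain ⟨rfl, rfl⟩ : a = 3 ∧ b = 3 := by omega
    rcases r with _ | _ | r
    · exact ⟨{3, 3}, by decide, ((((z.skip 2).skip 2).take 3).take 3).mono (by omega)⟩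
    · exact ⟨{3, 3}, by decide, ((((z.skip 2).skip 2).take 3).take 3).mono (by omega)⟩
    · have z' := TypeSplitsOff.zero n (List.replicate r 2)
      rw [Multiset.sum_coe, List.sum_replicate, smul_eq_mul] at z'
      exact ⟨{2, 2, 2, 2}, by decide, ((((((z'.take 2).take 2).take 2).take 2).skip 3).skip 3).mono
        (by omega)⟩

/-! ### Induction on the number of pairs, and boundedness -/

theorem even_sum_add_card_cycleType {α : Type*} [Fintype α] [DecidableEq α] {σ : Perm α}
    (hσ : sign σ = 1) : Even (σ.cycleType.sum + Multiset.card σ.cycleType) := by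
  rw [sign_of_cycleType] at hσ
  rwa [neg_one_pow_eq_one_iff_even (by decide)] at hσ

theorem exists_isProdTwoSixCycles_mul {n : ℕ} (hn : 8 ≤ n) {σ : Perm (Fin n)}
    (hσ : sign σ = 1) :
    ∃ π ρ : Perm (Fin n), π * ρ = σ ∧ IsProdTwoSixCycles π ∧
      (σ.support.card ≤ 8 → ρ = 1) ∧ ρ.support.card ≤ max 8 (σ.support.card - 8) := by
  have he := even_sum_add_card_cycleType hσ
  obtain ⟨l, hl, hlσ⟩ : ∃ l : List ℕ, l.Pairwise (· ≥ ·) ∧ (l : Multiset ℕ) = σ.cycleType :=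
    ⟨σ.cycleType.sort (· ≥ ·), Multiset.pairwise_sort _ _, Multiset.sort_eq _ _⟩
  have h2 : ∀ m ∈ l, 2 ≤ m := fun m hm => two_le_of_mem_cycleType (σ := σ) (by
    rw [← hlσ]; exact hm)
  rw [← hlσ, Multiset.sum_coe, Multiset.coe_card] at he
  have hs : l.sum = σ.support.card := by rw [← sum_cycleType, ← hlσ, Multiset.sum_coe]
  by_cases h8 : σ.support.card ≤ 8
  · refine ⟨σ, 1, mul_one σ, isProdTwoSixCycles_of_cycleType_mem hn ?_, fun _ => rfl, by simp⟩
    rw [← hlσ]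
    exact mem_twoSixCycleTypes_of_sum_le l h2 (hs ▸ h8) he
  · obtain ⟨p, hp, h⟩ := exists_typeSplitsOff n l hl h2 (by omega) he
    obtain ⟨π, ρ, h1, rfl, -, -, h5⟩ := h σ hlσ.symm
    exact ⟨π, ρ, h1, isProdTwoSixCycles_of_cycleType_mem hn hp, fun h => absurd h h8, hs ▸ h5⟩

theorem IsProdTwoSixCycles.sign_eq_one {n : ℕ} {σ : Perm (Fin n)} (h : IsProdTwoSixCycles σ) :
    sign σ = 1 := by
  obtain ⟨a, b, ha, hb, rfl⟩ := h
  rw [map_mul, sign_of_cycleType, sign_of_cycleType, ha, hb]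
  decide

theorem IsProdTwoSixCycles.isProdOfCycles_mul {n k : ℕ} {π ρ : Perm (Fin n)}
    (hπ : IsProdTwoSixCycles π) (hρ : IsProdOfCycles k 6 ρ) : IsProdOfCycles (k + 2) 6 (π * ρ) := by
  obtain ⟨a, b, ha, hb, rfl⟩ := hπ
  obtain ⟨L, hlen, hL, rfl⟩ := hρ
  refine ⟨a :: b :: L, by simp [hlen], ?_, by simp [mul_assoc]⟩
  simp only [List.mem_cons, forall_eq_or_imp]
  exact ⟨cycleType_eq_singleton_iff.1 ha, cycleType_eq_singleton_iff.1 hb, hL⟩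

theorem isProdOfCycles_six_of_card_support_le {n : ℕ} (hn : 8 ≤ n) (t : ℕ) (σ : Perm (Fin n))
    (hσ : sign σ = 1) (hs : σ.support.card ≤ 8 * t) : IsProdOfCycles (2 * t) 6 σ := by
  induction t generalizing σ with
  | zero =>
    have : σ = 1 := by simpa using hs
    exact ⟨[], rfl, by simp, this.symm⟩
  | succ t ih =>
    obtain ⟨π, ρ, rfl, hπ, h1, h8⟩ := exists_isProdTwoSixCycles_mul hn hσ
    refine hπ.isProdOfCycles_mul (ih ρ ?_ ?_)
    · rwa [map_mul, hπ.sign_eq_one, one_mul] at hσ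
    · by_cases h : (π * ρ).support.card ≤ 8
      · simp [h1 h]
      -- More than 8 moved symbols forces `t ≥ 1`, so the 8 in the maximum is harmless.
      · rcases t with _ | t <;> omega

theorem IsProdOfCycles.card_support_le {n k l : ℕ} {σ : Perm (Fin n)}
    (h : IsProdOfCycles k l σ) : σ.support.card ≤ k * l := by
  obtain ⟨L, rfl, hL, rfl⟩ := h
  induction L with
  | nil => simp
  | cons τ L ih =>
    have hτ := (hL τ List.mem_cons_self).2
    have hL' := ih fun τ h => hL τ (List.mem_cons_of_mem _ h)
    rw [List.prod_cons, List.length_cons, add_mul, one_mul]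
    refine (Finset.card_le_card (support_mul_le _ _)).trans ((Finset.card_union_le _ _).trans ?_)
    omega

theorem exists_mem_alternatingGroup_support_eq_univ {n : ℕ} (hn : 3 ≤ n) :
    ∃ σ ∈ alternatingGroup (Fin n), σ.support = Finset.univ := by
  obtain ⟨m, rfl⟩ : ∃ m, n = m + 3 := ⟨n - 3, by omega⟩
  -- A square is even, and `i + 2 ≠ i` modulo `m + 3`.
  refine ⟨finRotate (m + 3) ^ 2, ?_, ?_⟩
  · rw [mem_alternatingGroup, map_pow]
    exact Int.units_sq _
  · ext i
    simp only [mem_support, Finset.mem_univ, iff_true, pow_two, Perm.mul_apply, finRotate_apply]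
    intro h
    rw [add_assoc, add_eq_left, Fin.ext_iff] at h
    simp [Fin.val_add, Nat.mod_eq_of_lt] at h

theorem bddAbove_cycleCoverSet (k l : ℕ) : BddAbove (cycleCoverSet k l) := by
  refine ⟨max 2 (k * l), fun n hn => ?_⟩
  by_contra! h
  obtain ⟨σ, hσ, hu⟩ := exists_mem_alternatingGroup_support_eq_univ (n := n) (by omega)
  have := (hn σ hσ).card_support_le
  rw [hu, Finset.card_univ, Fintype.card_fin] at this
  omega

theorem mainTheorem5 (k : ℕ) (hk : 2 ≤ k) (hk_even : Even k) :
    IsGreatest (cycleCoverSet k 6) (maxCycleCover k 6) ∧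
      4 * k ≤ maxCycleCover k 6 ∧
      ∀ σ ∈ alternatingGroup (Fin (4 * k)), IsProdOfCycles k 6 σ := by
  have hmem : 4 * k ∈ cycleCoverSet k 6 := by
    intro σ hσ
    obtain ⟨t, rfl⟩ := even_iff_exists_two_mul.1 hk_even
    refine isProdOfCycles_six_of_card_support_le (by omega) t σ (mem_alternatingGroup.1 hσ) ?_
    have := σ.support.card_le_univ
    rw [Fintype.card_fin] at this
    omega
  have hb := bddAbove_cycleCoverSet k 6
  exact ⟨⟨Nat.sSup_mem ⟨_, hmem⟩ hb, fun n hn => le_csSup hb hn⟩, le_csSup hb hmem, hmem⟩
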